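/- Let $K$ be a finite extension of $\mathbb{Q}$. For a power series $h=\sum a_{i_0,\dots,i_n}x_0^{i_0}\cdots x_n^{i_n}\in K[[x_0,\dots,x_n]]$ write $\Delta_n(h)=\sum_{i\ge 0}a_{i,\dots,i}x^i\in K[[x]]$ for its diagonal, let $K\{x_0,\dots,x_n\}\subset K[[x_0,\dots,x_n]]$ be the subring of series algebraic over $K(x_0,\dots,x_n)$, and regard $K[x_0,\dots,x_n]_{(x_0,\dots,x_n)}$, the ring of rational functions $P/Q$ with $Q(0,\dots,0)\ne 0$, as a subring of $K[[x_0,\dots,x_n]]$ by Taylor expansion at the origin. For $f\in K[[x]]$ let $\mathbf{dg}(f)\in\{0,1,2,\dots,\infty\}$ be the smallest $n\ge 0$ such that $f=\Delta_n(h)$ for some $h\in K[x_0,\dots,x_n]_{(x_0,\dots,x_n)}$ ($\infty$ if there is no such $n$). Let $\mathbf{hg}(f)$ be $0$ if $f$ is rational, and otherwise the smallest $k\ge 1$ such that $f$ is the Hadamard (coefficientwise) product $h_1*\cdots*h_k$ of $k$ series $h_i\in K[[x]]$ algebraic over $K(x)$ ($\infty$ if there is no such $k$). Let $f\in K[[x]]$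 be $D$-finite, i.e. annihilated by a nonzero linear differential operator in $x\frac{d}{dx}$ with coefficients in $K(x)$. Then for every integer $n\ge 0$ the following are equivalent: (I) there is $g\in K\{x_0,\dots,x_n\}$ with $f=\Delta_n(g)$; (II) there is $h\in K[x_0,\dots,x_{n+1}]_{(x_0,\dots,x_{n+1})}$ with $f=\Delta_{n+1}(h)$. In particular, $\mathbf{dg}(f)\le\mathbf{hg}(f)$. -/

import Mathlib

namespace DiagonalGrade

open scoped Polynomial

noncomputable section

variable {K : Type*} [Field K]

/-- The operator `x * d/dx` on univariate power series. -/
def eulerDeriv (f : PowerSeries K) : PowerSeries K :=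
  PowerSeries.X * PowerSeries.derivative K f

/-- `f` is D-finite: it is annihilated by a nonzero linear differential operator
`∑ i ≤ r, p i * (x * d/dx) ^ i`. Polynomial coefficients suffice, since the denominators of an
operator with coefficients in `K(x)` can be cleared. -/
def IsDFinite (f : PowerSeries K) : Prop :=
  ∃ (r : ℕ) (p : Fin (r + 1) → K[X]), p ≠ 0 ∧
    ∑ i : Fin (r + 1), (p i : PowerSeries K) * eulerDeriv^[(i : ℕ)] f = 0

/-- `h` is the Taylor expansion at the origin of a rational function `P / Q` with `Q(0) ≠ 0`,
i.e. `h` lies in the localization of `K[x_0, …, x_n]` at `(x_0, …, x_n)`, seen inside the ring of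
formal power series. -/
def IsRegularRational {n : ℕ} (h : MvPowerSeries (Fin (n + 1)) K) : Prop :=
  ∃ P Q : MvPolynomial (Fin (n + 1)) K, MvPolynomial.constantCoeff Q ≠ 0 ∧
    (Q : MvPowerSeries (Fin (n + 1)) K) * h = P

/-- `g` is algebraic over the polynomials (equivalently, over the rational functions) in
`x_0, …, x_n`. -/
def IsAlgebraicSeries {n : ℕ} (g : MvPowerSeries (Fin (n + 1)) K) : Prop :=
  IsAlgebraic (MvPolynomial (Fin (n + 1)) K) g

/-- The diagonal `∑ i, a_{i,…,i} x ^ i` of a series in the variables `x_0, …, x_n`. -/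
def diagonal {n : ℕ} (h : MvPowerSeries (Fin (n + 1)) K) : PowerSeries K :=
  PowerSeries.mk fun i => MvPowerSeries.coeff (Finsupp.equivFunOnFinite.symm fun _ => i) h

/-- The smallest `n` such that `f` is the diagonal of a rational function in `x_0, …, x_n` regular
at the origin, and `⊤` if there is none. -/
def diagonalGrade (f : PowerSeries K) : ℕ∞ :=
  sInf {k : ℕ∞ | ∃ n : ℕ, k = n ∧
    ∃ h : MvPowerSeries (Fin (n + 1)) K, IsRegularRational h ∧ f = diagonal h}

/-- The univariate series `f` is (the expansion of) a rational function. -/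
def IsRationalSeries (f : PowerSeries K) : Prop :=
  ∃ P Q : K[X], Q ≠ 0 ∧ (Q : PowerSeries K) * f = P

/-- The Hadamard (coefficientwise) product of `k` univariate series. -/
def hadamardProd {k : ℕ} (h : Fin k → PowerSeries K) : PowerSeries K :=
  PowerSeries.mk fun m => ∏ i, PowerSeries.coeff m (h i)

open Classical in
/-- `0` for a rational series, otherwise the smallest `k ≥ 1` such that `f` is the Hadamard product
of `k` algebraic series, and `⊤` if there is none. -/
def hadamardGrade (f : PowerSeries K) : ℕ∞ :=
  if IsRationalSeries f then 0 else
    sInf {l : ℕ∞ | ∃ k : ℕ, l = k ∧ 1 ≤ k ∧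
      ∃ h : Fin k → PowerSeries K, (∀ i, IsAlgebraic K[X] (h i)) ∧ f = hadamardProd h}

end

end DiagonalGrade

/-!
The coefficient of `y ^ 0` in the Laurent expansion of `h (y, x₀ / y, x₁, …, xₙ)` has the same
diagonal as `h`, and both implications come from computing it by residues (Furstenberg). If `h` is
rational, with denominator `D = S * L` where `S` collects the roots `y` of `D` that vanish at the
origin, then the partial fraction with denominator `S` does not contribute, and the coefficient is
the value at `y = 0` of the one with denominator `L`. By Weierstrass preparation and integrality,
`S`, `L` and therefore this value are algebraic.

Conversely, if `z` is a simple root of a polynomial `F` in `y`, then the residue of `y * F' / F` at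
`z` is `z`, so that `z` arises in this way from a rational function. A substitution
`xᵢ ↦ xᵢ * (x₀ ⋯ xₙ) ^ wᵢ`, which only replaces the diagonal `f (x)` by `f (x ^ d)` and is undone by
keeping every `d`-th exponent, reduces an algebraic series to this situation: after it, a root of a
separable equation is a polynomial plus a monomial times a simple root, as in Newton's lemma.

A Hadamard product of algebraic series is the diagonal of their product in separate variables.
-/

namespace DiagonalGrade

open scoped Polynomial

noncomputable section

section Monomials

variable {σ τ R : Type*}

section Substitution

variable [CommRing R] (φ : (σ →₀ ℕ) →+ (τ →₀ ℕ)) (hφ : Function.Injective φ)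

/-- The substitution `t ^ u ↦ t ^ φ u` of monomials for the variables of a polynomial, given by
its effect `φ` on exponents. -/
def substMonomialsPoly : MvPolynomial σ R →ₐ[R] MvPolynomial τ R :=
  MvPolynomial.aeval fun i => MvPolynomial.monomial (φ (Finsupp.single i 1)) 1

theorem substMonomialsPoly_monomial (u : σ →₀ ℕ) (r : R) :
    substMonomialsPoly φ (MvPolynomial.monomial u r) = MvPolynomial.monomial (φ u) r := by
  conv_rhs => rw [← u.sum_single, Finsupp.sum, map_sum]
  rw [substMonomialsPoly, MvPolynomial.aeval_monomial, MvPolynomial.monomial_sum_index,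
    MvPolynomial.algebraMap_eq, Finsupp.prod]
  simp [MvPolynomial.monomial_pow, ← map_nsmul]

theorem prod_monomial_map_single (u : σ →₀ ℕ) :
    (u.prod fun i k => MvPowerSeries.monomial (φ (Finsupp.single i 1)) (1 : R) ^ k) =
      MvPowerSeries.monomial (φ u) 1 := by
  simp only [Finsupp.prod, MvPowerSeries.monomial_pow, MvPowerSeries.prod_monomial, one_pow,
    Finset.prod_const_one]
  conv_rhs => rw [← u.sum_single, Finsupp.sum, map_sum]
  simp only [← map_nsmul, Finsupp.smul_single, smul_eq_mul, mul_one]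

include hφ in
theorem hasSubst_monomial [Finite σ] :
    MvPowerSeries.HasSubst fun i : σ =>
      MvPowerSeries.monomial (φ (Finsupp.single i 1)) (1 : R) := by
  classical
  refine MvPowerSeries.hasSubst_of_constantCoeff_zero fun i => ?_
  rw [← MvPowerSeries.coeff_zero_eq_constantCoeff_apply, MvPowerSeries.coeff_monomial, if_neg]
  simp [eq_comm (a := (0 : τ →₀ ℕ)), map_eq_zero_iff φ hφ]

variable [Finite σ]

/-- The substitution `t ^ u ↦ t ^ φ u` of monomials for the variables of a power series, given by
its effect `φ` on exponents. -/
def substMonomials : MvPowerSeries σ R →ₐ[R] MvPowerSeries τ R :=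
  MvPowerSeries.substAlgHom (hasSubst_monomial φ hφ)

@[simp]
theorem substMonomials_X (i : σ) :
    substMonomials φ hφ (MvPowerSeries.X i : MvPowerSeries σ R) =
      MvPowerSeries.monomial (φ (Finsupp.single i 1)) 1 :=
  MvPowerSeries.substAlgHom_X _ _

theorem coeff_substMonomials_eq_finsum (f : MvPowerSeries σ R) (e : τ →₀ ℕ) :
    MvPowerSeries.coeff e (substMonomials φ hφ f) =
      ∑ᶠ u, MvPowerSeries.coeff u f *
        MvPowerSeries.coeff e (MvPowerSeries.monomial (φ u) (1 : R)) := by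
  rw [substMonomials, MvPowerSeries.substAlgHom_apply,
    MvPowerSeries.coeff_subst (hasSubst_monomial φ hφ)]
  simp only [prod_monomial_map_single, smul_eq_mul]

@[simp]
theorem coeff_substMonomials (f : MvPowerSeries σ R) (u : σ →₀ ℕ) :
    MvPowerSeries.coeff (φ u) (substMonomials φ hφ f) = MvPowerSeries.coeff u f := by
  classical
  rw [coeff_substMonomials_eq_finsum, finsum_eq_single _ u fun v hv => ?_]
  · simp
  · rw [MvPowerSeries.coeff_monomial, if_neg (hφ.ne hv.symm), mul_zero]

theorem exists_of_coeff_substMonomials_ne_zero {f : MvPowerSeries σ R} {e : τ →₀ ℕ}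
    (he : MvPowerSeries.coeff e (substMonomials φ hφ f) ≠ 0) :
    ∃ u, φ u = e ∧ MvPowerSeries.coeff u f ≠ 0 := by
  classical
  contrapose! he
  rw [coeff_substMonomials_eq_finsum]
  refine finsum_eq_zero_of_forall_eq_zero fun u => ?_
  rw [MvPowerSeries.coeff_monomial]
  split_ifs with h
  · rw [he u h.symm, zero_mul]
  · rw [mul_zero]

theorem coe_substMonomialsPoly (P : MvPolynomial σ R) :
    (substMonomialsPoly φ P : MvPowerSeries τ R) = substMonomials φ hφ P := by
  rw [substMonomials, MvPowerSeries.substAlgHom_coe]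
  have h := MvPolynomial.comp_aeval_apply (R := R)
    (fun i => MvPolynomial.monomial (φ (Finsupp.single i 1)) (1 : R))
    (MvPolynomial.coeToMvPowerSeries.algHom (σ := τ) (R := R) R) P
  simpa only [substMonomialsPoly, MvPolynomial.coeToMvPowerSeries.algHom_apply,
    Algebra.algebraMap_self, MvPowerSeries.map_id, RingHom.id_apply, MvPolynomial.coe_monomial]
    using h

end Substitution

section Pullback

variable [Semiring R] (φ : (σ →₀ ℕ) →+ (τ →₀ ℕ)) (c : τ →₀ ℕ)

/-- The series whose coefficient at `u` is the coefficient of `h` at `φ u + c`. -/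
def pullback : MvPowerSeries τ R →ₗ[R] MvPowerSeries σ R where
  toFun h := fun u => MvPowerSeries.coeff (φ u + c) h
  map_add' _ _ := rfl
  map_smul' _ _ := rfl

@[simp]
theorem coeff_pullback (h : MvPowerSeries τ R) (u : σ →₀ ℕ) :
    MvPowerSeries.coeff u (pullback φ c h) = MvPowerSeries.coeff (φ u + c) h :=
  rfl

variable {φ c}

theorem injective_of_le_of_map_le_add (hc : ∀ a u, φ a ≤ φ u + c → a ≤ u) :
    Function.Injective φ := fun a b h =>
  le_antisymm (hc a b (h ▸ le_self_add)) (hc b a (h ▸ le_self_add))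

theorem pullback_mul (hc : ∀ a u, φ a ≤ φ u + c → a ≤ u) {x : MvPowerSeries τ R}
    (hx : ∀ e, MvPowerSeries.coeff e x ≠ 0 → e ∈ Set.range φ) (h : MvPowerSeries τ R) :
    pullback φ c (x * h) = pullback φ 0 x * pullback φ c h := by
  classical
  ext u
  rw [coeff_pullback, MvPowerSeries.coeff_mul, MvPowerSeries.coeff_mul]
  symm
  refine Finset.sum_of_injOn (fun p => (φ p.1, φ p.2 + c)) ?_ ?_ ?_ ?_
  · have hφ := injective_of_le_of_map_le_add hc
    rintro ⟨a, b⟩ - ⟨a', b'⟩ - h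
    simp only [Prod.mk.injEq, add_left_inj] at h
    exact Prod.ext (hφ h.1) (hφ h.2)
  · rintro ⟨a, b⟩ h
    simp only [Finset.mem_coe, Finset.HasAntidiagonal.mem_antidiagonal] at h ⊢
    rw [← add_assoc, ← map_add, h]
  · rintro ⟨a, b⟩ h hn
    by_contra h0
    obtain ⟨a', rfl⟩ := hx a (left_ne_zero_of_mul h0)
    rw [Finset.HasAntidiagonal.mem_antidiagonal] at h
    obtain ⟨b', rfl⟩ := exists_add_of_le (hc a' u (h ▸ le_self_add))
    refine hn ⟨(a', b'), by simp, ?_⟩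
    simpa [add_assoc, eq_comm] using h
  · simp

end Pullback

theorem exists_coe_eq_pullback [CommSemiring R] {φ : (σ →₀ ℕ) →+ (τ →₀ ℕ)}
    (hφ : Function.Injective φ) (c : τ →₀ ℕ) (P : MvPolynomial τ R) :
    ∃ P' : MvPolynomial σ R, (P' : MvPowerSeries σ R) = pullback φ c (P : MvPowerSeries τ R) := by
  have hfin : {u | MvPolynomial.coeff (φ u + c) P ≠ 0}.Finite := by
    refine (P.support.finite_toSet.preimage (f := fun u => φ u + c)
      ((add_left_injective c).comp hφ).injOn).subset fun u hu => ?_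
    simpa using hu
  refine ⟨MvPowerSeries.truncFinset R hfin.toFinset (pullback φ c P), ?_⟩
  ext u
  rw [MvPolynomial.coeff_coe]
  by_cases hu : u ∈ hfin.toFinset
  · rw [MvPowerSeries.coeff_truncFinset_of_mem _ hu]
  · rw [MvPowerSeries.coeff_truncFinset_eq_zero _ hu]
    simpa [eq_comm] using hu

end Monomials

section Multisection

variable {σ R : Type*}

/-- The series whose coefficient at `e` is the coefficient of `f` at `d • e`. -/
def multisection [Semiring R] (d : ℕ) : MvPowerSeries σ R →ₗ[R] MvPowerSeries σ R :=
  pullback (nsmulAddMonoidHom d) 0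

@[simp]
theorem coeff_multisection [Semiring R] (d : ℕ) (f : MvPowerSeries σ R) (e : σ →₀ ℕ) :
    MvPowerSeries.coeff e (multisection d f) = MvPowerSeries.coeff (d • e) f := by
  simp [multisection]

theorem le_of_nsmul_le_nsmul {d : ℕ} (hd : d ≠ 0) {a b : σ →₀ ℕ} (h : d • a ≤ d • b) : a ≤ b :=
  fun i => Nat.le_of_mul_le_mul_left (h i) (Nat.pos_of_ne_zero hd)

theorem exists_nsmul_eq_of_coeff_expand_ne_zero [CommSemiring R] {d : ℕ} {P : MvPolynomial σ R}
    {e : σ →₀ ℕ} (he : MvPolynomial.coeff e (MvPolynomial.expand d P) ≠ 0) : ∃ u, d • u = e := by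
  have hdvd : ∀ i, d ∣ e i := fun i => by
    by_contra h
    exact he (MvPolynomial.coeff_expand_of_not_dvd P h)
  refine ⟨e.mapRange (· / d) (by simp), ?_⟩
  ext i
  simpa using Nat.mul_div_cancel' (hdvd i)

theorem multisection_expand_mul [CommSemiring R] {d : ℕ} (hd : d ≠ 0) (P : MvPolynomial σ R)
    (f : MvPowerSeries σ R) :
    multisection d ((MvPolynomial.expand d P : MvPolynomial σ R) * f : MvPowerSeries σ R) =
      P * multisection d f := by
  rw [multisection, pullback_mul]
  · congr 1
    ext e
    simp [hd]
  · intro a u h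
    exact le_of_nsmul_le_nsmul hd (by simpa using h)
  · intro e he
    exact exists_nsmul_eq_of_coeff_expand_ne_zero (by simpa using he)

theorem isIntegral_expand [CommRing R] {d : ℕ} (hd : d ≠ 0) :
    (MvPolynomial.expand d : MvPolynomial σ R →ₐ[R] MvPolynomial σ R).toRingHom.IsIntegral := by
  intro P
  induction P using MvPolynomial.induction_on with
  | C r =>
    simpa using (MvPolynomial.expand d : MvPolynomial σ R →ₐ[R] _).toRingHom.isIntegralElem_map
      (x := MvPolynomial.C r)
  | add p q hp hq => exact hp.add _ hq
  | mul_X p i hp =>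
    refine hp.mul _ ⟨Polynomial.X ^ d - Polynomial.C (MvPolynomial.X i), ?_, ?_⟩
    · exact Polynomial.monic_X_pow_sub_C _ hd
    · simp

theorem sub_C_constantCoeff_mem [CommRing R] {I : Ideal (MvPolynomial σ R)}
    (hI : ∀ i, MvPolynomial.X i ∈ I) (Q : MvPolynomial σ R) :
    Q - MvPolynomial.C (MvPolynomial.constantCoeff Q) ∈ I := by
  have h : Q - MvPolynomial.C (MvPolynomial.constantCoeff Q) ∈ MvPolynomial.idealOfVars σ R := by
    rw [← pow_one (MvPolynomial.idealOfVars σ R), MvPolynomial.mem_pow_idealOfVars_iff']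
    intro x hx
    obtain rfl : x = 0 := (Finsupp.degree_eq_zero_iff x).1 (Nat.lt_one_iff.1 hx)
    simp [MvPolynomial.constantCoeff_eq]
  refine (Ideal.span_le.2 ?_ : MvPolynomial.idealOfVars σ R ≤ I) h
  rintro _ ⟨i, rfl⟩
  exact hI i

-- Otherwise, as `expand d` is integral, some prime over `(x_i)_i` would contain `Q`.
theorem exists_mul_eq_expand [CommRing R] [IsDomain R] {d : ℕ} (hd : d ≠ 0) {Q : MvPolynomial σ R}
    (hQ : MvPolynomial.constantCoeff Q ≠ 0) :
    ∃ A Q' : MvPolynomial σ R, MvPolynomial.constantCoeff Q' ≠ 0 ∧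
      A * Q = MvPolynomial.expand d Q' := by
  let E := (MvPolynomial.expand d : MvPolynomial σ R →ₐ[R] MvPolynomial σ R).toRingHom
  let := E.toAlgebra
  have hint : Algebra.IsIntegral (MvPolynomial σ R) (MvPolynomial σ R) := ⟨isIntegral_expand hd⟩
  let P := RingHom.ker (MvPolynomial.constantCoeff : MvPolynomial σ R →+* R)
  have hP : P.IsPrime := RingHom.ker_isPrime _
  by_contra! hne
  have hle : (Ideal.span {Q}).comap E ≤ P := fun Q' hQ' => by
    obtain ⟨A, hA⟩ := Ideal.mem_span_singleton'.1 hQ'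
    by_contra h0
    exact hne A Q' h0 hA
  obtain ⟨𝔮, hQ𝔮, h𝔮, hover⟩ :=
    Ideal.exists_ideal_over_prime_of_isIntegral P (Ideal.span {Q}) hle
  have hmem : ∀ p, E p ∈ 𝔮 ↔ MvPolynomial.constantCoeff p = 0 := fun p => by
    rw [← RingHom.mem_ker, ← Ideal.mem_comap]
    exact Ideal.ext_iff.1 hover p
  have hX : ∀ i, MvPolynomial.X i ∈ 𝔮 := fun i => by
    refine h𝔮.mem_of_pow_mem d ?_
    simpa [E] using (hmem (MvPolynomial.X i)).2 (by simp)
  have hC : MvPolynomial.C (MvPolynomial.constantCoeff Q) ∈ 𝔮 := by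
    simpa only [sub_sub_cancel] using
      𝔮.sub_mem (hQ𝔮 (Ideal.mem_span_singleton_self Q)) (sub_C_constantCoeff_mem hX Q)
  refine hQ ?_
  simpa [E] using (hmem (MvPolynomial.C (MvPolynomial.constantCoeff Q))).1 (by simpa [E] using hC)

end Multisection

variable {K : Type*} [Field K]

theorem IsRegularRational.multisection {n d : ℕ} (hd : d ≠ 0)
    {h : MvPowerSeries (Fin (n + 1)) K} (hh : IsRegularRational h) :
    IsRegularRational (multisection d h) := by
  obtain ⟨P, Q, hQ, hP⟩ := hh
  obtain ⟨A, Q', hQ', hA⟩ := exists_mul_eq_expand hd hQ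
  obtain ⟨P', hP'⟩ := exists_coe_eq_pullback (φ := nsmulAddMonoidHom d)
    (fun a b h => smul_right_injective _ hd h) 0 (A * P)
  refine ⟨P', Q', hQ', ?_⟩
  rw [hP', ← multisection_expand_mul hd, ← hA, MvPolynomial.coe_mul, MvPolynomial.coe_mul,
    mul_assoc, hP]
  rfl

theorem IsRegularRational.coe_add_coe_mul {n : ℕ} (A B : MvPolynomial (Fin (n + 1)) K)
    {h : MvPowerSeries (Fin (n + 1)) K} (hh : IsRegularRational h) :
    IsRegularRational (A + B * h : MvPowerSeries (Fin (n + 1)) K) := by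
  obtain ⟨P, Q, hQ, hP⟩ := hh
  refine ⟨Q * A + B * P, Q, hQ, ?_⟩
  rw [MvPolynomial.coe_add, MvPolynomial.coe_mul, MvPolynomial.coe_mul, ← hP]
  ring

section Residue

variable {n : ℕ} {R : Type*}

/-- The embedding `u ↦ (u 0, u)` of exponents. Its range consists of the exponents balanced in the
first two variables, which the partial diagonal keeps. -/
def balancedEmb (n : ℕ) : (Fin (n + 1) →₀ ℕ) →+ (Fin (n + 1 + 1) →₀ ℕ) where
  toFun u := u.cons (u 0)
  map_zero' := by simp
  map_add' u v := by
    ext i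
    cases i using Fin.cases <;> simp

/-- The map on exponents induced by the substitution of `x₀ * x₁` for `x₁`. -/
def shearEmb (n : ℕ) : (Fin (n + 1 + 1) →₀ ℕ) →+ (Fin (n + 1 + 1) →₀ ℕ) where
  toFun e := e + Finsupp.single 0 (e 1)
  map_zero' := by simp
  map_add' e e' := by
    simp only [Finsupp.coe_add, Pi.add_apply, Finsupp.single_add]
    abel

theorem balancedEmb_apply (u : Fin (n + 1) →₀ ℕ) : balancedEmb n u = u.cons (u 0) := rfl

theorem balancedEmb_add_single (u : Fin (n + 1) →₀ ℕ) (k : ℕ) :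
    balancedEmb n u + Finsupp.single 0 k = u.cons (k + u 0) := by
  ext i
  cases i using Fin.cases <;> simp [balancedEmb_apply, add_comm]

theorem shearEmb_cons (k : ℕ) (u : Fin (n + 1) →₀ ℕ) :
    shearEmb n (u.cons k) = u.cons (k + u 0) := by
  ext i
  cases i using Fin.cases <;> simp [shearEmb, ← Fin.succ_zero_eq_one, -Fin.succ_zero_eq_one']

theorem shearEmb_injective : Function.Injective (shearEmb n) := fun e e' h => by
  rw [← Finsupp.cons_tail e, ← Finsupp.cons_tail e', shearEmb_cons, shearEmb_cons] at h
  obtain ⟨h0, htail⟩ := Finsupp.cons_injective2 h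
  rw [htail, add_left_inj] at h0
  rw [← Finsupp.cons_tail e, ← Finsupp.cons_tail e', h0, htail]

/-- The coefficient of `y ^ k` in the Laurent expansion of `h (y, x₀ / y, x₁, …, xₙ)`, as a series
in `x₀, …, xₙ`; the series `yCoeff 0 h` is the partial diagonal of `h` in its first two
variables. -/
def yCoeff [Semiring R] (k : ℕ) :
    MvPowerSeries (Fin (n + 1 + 1)) R →ₗ[R] MvPowerSeries (Fin (n + 1)) R :=
  pullback (balancedEmb n) (Finsupp.single 0 k)

theorem coeff_yCoeff [Semiring R] (k : ℕ) (h : MvPowerSeries (Fin (n + 1 + 1)) R)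
    (u : Fin (n + 1) →₀ ℕ) :
    MvPowerSeries.coeff u (yCoeff k h) = MvPowerSeries.coeff (u.cons (k + u 0)) h := by
  rw [yCoeff, coeff_pullback, balancedEmb_add_single]

theorem yCoeff_X_pow_mul [CommSemiring R] (i k : ℕ) (h : MvPowerSeries (Fin (n + 1 + 1)) R) :
    yCoeff (i + k) (MvPowerSeries.X 0 ^ i * h) = yCoeff k h := by
  ext u
  rw [coeff_yCoeff, coeff_yCoeff, MvPowerSeries.X_pow_eq, ← balancedEmb_add_single,
    Finsupp.single_add, add_left_comm, MvPowerSeries.coeff_add_monomial_mul, one_mul,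
    balancedEmb_add_single]

variable [CommRing R]

/-- The series `w (y, x₀ * y, x₁, …, xₙ)` in the variables `y, x₀, …, xₙ`, for a series `w` in `y`
with coefficients in the series in `x₀, …, xₙ`. -/
def shearSubst : PowerSeries (MvPowerSeries (Fin (n + 1)) R) →ₐ[R]
    MvPowerSeries (Fin (n + 1 + 1)) R :=
  (substMonomials (shearEmb n) shearEmb_injective).comp
    (MvPowerSeries.finSuccEquiv R (n + 1)).symm.toAlgHom

theorem shearSubst_apply (w : PowerSeries (MvPowerSeries (Fin (n + 1)) R)) :
    shearSubst w = substMonomials (shearEmb n) shearEmb_injective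
      ((MvPowerSeries.finSuccEquiv R (n + 1)).symm w) :=
  rfl

theorem coeff_cons_finSuccEquiv_symm (w : PowerSeries (MvPowerSeries (Fin n) R)) (k : ℕ)
    (u : Fin n →₀ ℕ) :
    MvPowerSeries.coeff (u.cons k) ((MvPowerSeries.finSuccEquiv R n).symm w) =
      MvPowerSeries.coeff u (PowerSeries.coeff k w) := by
  rw [← MvPowerSeries.coeff_coeff_finSuccEquiv, AlgEquiv.apply_symm_apply]

theorem yCoeff_shearSubst (w : PowerSeries (MvPowerSeries (Fin (n + 1)) R)) (k : ℕ) :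
    yCoeff k (shearSubst w) = PowerSeries.coeff k w := by
  ext u
  rw [coeff_yCoeff, ← shearEmb_cons, shearSubst_apply, coeff_substMonomials,
    coeff_cons_finSuccEquiv_symm]

theorem shearSubst_X :
    shearSubst (PowerSeries.X : PowerSeries (MvPowerSeries (Fin (n + 1)) R)) =
      MvPowerSeries.X 0 := by
  rw [shearSubst_apply, ← MvPowerSeries.finSuccEquiv_X_zero, AlgEquiv.symm_apply_apply,
    substMonomials_X, MvPowerSeries.X]
  congr 1
  simp [shearEmb]

theorem mem_range_balancedEmb_of_coeff_shearSubst_C_ne_zero {f : MvPowerSeries (Fin (n + 1)) R}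
    {e : Fin (n + 1 + 1) →₀ ℕ}
    (he : MvPowerSeries.coeff e (shearSubst (PowerSeries.C f)) ≠ 0) :
    e ∈ Set.range (balancedEmb n) := by
  rw [shearSubst_apply] at he
  obtain ⟨v, rfl, hv⟩ := exists_of_coeff_substMonomials_ne_zero _ _ he
  rw [← Finsupp.cons_tail v] at hv ⊢
  rw [coeff_cons_finSuccEquiv_symm, PowerSeries.coeff_C] at hv
  have h0 : v 0 = 0 := by
    by_contra h0
    simp [h0] at hv
  exact ⟨v.tail, by rw [shearEmb_cons, balancedEmb_apply, h0, zero_add]⟩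

theorem yCoeff_shearSubst_C_mul (f : MvPowerSeries (Fin (n + 1)) R) (k : ℕ)
    (h : MvPowerSeries (Fin (n + 1 + 1)) R) :
    yCoeff k (shearSubst (PowerSeries.C f) * h) = f * yCoeff k h := by
  rw [yCoeff, pullback_mul (fun a u hau i => ?_)
    fun e => mem_range_balancedEmb_of_coeff_shearSubst_C_ne_zero]
  · congr 1
    simpa [yCoeff] using yCoeff_shearSubst (PowerSeries.C f) 0
  · rw [balancedEmb_add_single] at hau
    simpa [balancedEmb_apply] using hau i.succ

theorem yCoeff_shearSubst_coe_mul {p : (MvPowerSeries (Fin (n + 1)) R)[X]} {m : ℕ}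
    (hp : p.natDegree ≤ m) (k : ℕ) (h : MvPowerSeries (Fin (n + 1 + 1)) R) :
    yCoeff (m + k) (shearSubst p * h) =
      ∑ i ∈ Finset.range (m + 1), p.coeff i * yCoeff (m - i + k) h := by
  have hsum : (p : PowerSeries (MvPowerSeries (Fin (n + 1)) R)) =
      ∑ i ∈ Finset.range (m + 1), PowerSeries.C (p.coeff i) * PowerSeries.X ^ i := by
    conv_lhs => rw [p.as_sum_range_C_mul_X_pow' (Nat.lt_succ_of_le hp),
      ← Polynomial.coeToPowerSeries.ringHom_apply, map_sum]
    simp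
  simp only [hsum, map_sum, map_mul, map_pow, shearSubst_X, Finset.sum_mul, mul_assoc,
    yCoeff_shearSubst_C_mul]
  refine Finset.sum_congr rfl fun i hi => ?_
  rw [show m + k = i + (m - i + k) by grind, yCoeff_X_pow_mul]

-- The coefficients of `y ^ k` in `h` satisfy the recurrence with characteristic polynomial `S`,
-- whose lower coefficients lie in `I`; hence they lie in every power of `I`.
theorem yCoeff_eq_zero_of_shearSubst_mul_eq {S r : (MvPowerSeries (Fin (n + 1)) R)[X]}
    (hS : S.IsDistinguishedAt (Ideal.span (Set.range MvPowerSeries.X)))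
    (hr : r.degree < S.degree) {h : MvPowerSeries (Fin (n + 1 + 1)) R}
    (hh : shearSubst (S : PowerSeries _) * h = shearSubst r) (k : ℕ) : yCoeff k h = 0 := by
  set I : Ideal (MvPowerSeries (Fin (n + 1)) R) := Ideal.span (Set.range MvPowerSeries.X)
  have hrec : ∀ k, yCoeff k h =
      -∑ i ∈ Finset.range S.natDegree, S.coeff i * yCoeff (S.natDegree - i + k) h := fun k => by
    have hk := yCoeff_shearSubst_coe_mul le_rfl k h (p := S)
    rw [hh, yCoeff_shearSubst, Polynomial.coeff_coe, Finset.sum_range_succ,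
      hS.monic.coeff_natDegree, Nat.sub_self, zero_add, one_mul,
      Polynomial.coeff_eq_zero_of_degree_lt (hr.trans_le (Polynomial.degree_le_natDegree.trans
        (by exact_mod_cast Nat.le_add_right _ _)))] at hk
    exact eq_neg_of_add_eq_zero_right hk.symm
  have hmem : ∀ N k, yCoeff k h ∈ I ^ N := fun N => by
    induction N with
    | zero => simp
    | succ N ih =>
      intro k
      rw [hrec, pow_succ']
      exact neg_mem (sum_mem fun i hi =>
        Ideal.mul_mem_mul (hS.mem (Finset.mem_range.1 hi)) (ih _))
  refine IsHausdorff.haus (I := I) inferInstance _ fun N => ?_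
  rw [SModEq.zero]
  simpa using hmem N k

-- With `L` inverted as a power series in `y`, this is the residue formula for `G / L + r / S`:
-- the second summand, expanded at infinity, has only negative powers of `y`.
theorem coeff_zero_mul_yCoeff_zero_of_shearSubst_mul_eq
    {S L G r : (MvPowerSeries (Fin (n + 1)) R)[X]}
    (hS : S.IsDistinguishedAt (Ideal.span (Set.range MvPowerSeries.X)))
    (hL : IsUnit (L.coeff 0)) (hr : r.degree < S.degree) {h : MvPowerSeries (Fin (n + 1 + 1)) R}
    (hh : shearSubst ↑(S * L) * h = shearSubst ↑(S * G + r * L)) :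
    L.coeff 0 * yCoeff 0 h = G.coeff 0 := by
  obtain ⟨L', hL'⟩ : ∃ L' : PowerSeries (MvPowerSeries (Fin (n + 1)) R), L * L' = 1 :=
    IsUnit.exists_right_inv <| PowerSeries.isUnit_iff_constantCoeff.2 <| by
      rwa [Polynomial.constantCoeff_coe]
  have hzero : yCoeff 0 (h - shearSubst ((G : PowerSeries _) * L')) = 0 := by
    refine yCoeff_eq_zero_of_shearSubst_mul_eq hS hr ?_ 0
    have hLL := congrArg (shearSubst (R := R)) hL'
    simp only [Polynomial.coe_mul, Polynomial.coe_add, map_mul, map_add, map_one] at hh hLL ⊢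
    linear_combination shearSubst L' * hh + (shearSubst r - shearSubst S * h) * hLL
  rw [map_sub, sub_eq_zero, yCoeff_shearSubst] at hzero
  have h0 := congrArg PowerSeries.constantCoeff hL'
  simp only [map_mul, Polynomial.constantCoeff_coe, map_one] at h0
  simp only [hzero, PowerSeries.coeff_zero_eq_constantCoeff_apply, map_mul,
    Polynomial.constantCoeff_coe]
  linear_combination G.coeff 0 * h0

theorem diagonal_yCoeff_zero {K : Type*} [Field K] (h : MvPowerSeries (Fin (n + 1 + 1)) K) :
    diagonal (yCoeff 0 h) = diagonal h := by
  ext i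
  simp only [diagonal, PowerSeries.coeff_mk, coeff_yCoeff]
  congr 2
  ext j
  cases j using Fin.cases <;> simp

end Residue

section AlgebraMap

variable {σ R : Type*}

theorem algebraMap_mvPowerSeries_apply [CommSemiring R] (P : MvPolynomial σ R) :
    algebraMap (MvPolynomial σ R) (MvPowerSeries σ R) P = P := by
  rw [MvPowerSeries.algebraMap_apply', Algebra.algebraMap_self, MvPowerSeries.map_id,
    RingHom.id_apply]

theorem constantCoeff_algebraMap_mvPowerSeries [CommSemiring R] (P : MvPolynomial σ R) :
    MvPowerSeries.constantCoeff (algebraMap (MvPolynomial σ R) (MvPowerSeries σ R) P) =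
      MvPolynomial.constantCoeff P := by
  rw [algebraMap_mvPowerSeries_apply, ← MvPowerSeries.coeff_zero_eq_constantCoeff_apply,
    MvPolynomial.coeff_coe, MvPolynomial.constantCoeff_eq]

end AlgebraMap

section ShearPolynomials

variable {n : ℕ} {R : Type*} [CommRing R]

/-- The restriction of `shearSubst` to polynomials. -/
def shearPoly : (MvPolynomial (Fin (n + 1)) R)[X] →ₐ[R] MvPolynomial (Fin (n + 1 + 1)) R :=
  (substMonomialsPoly (shearEmb n)).comp (MvPolynomial.finSuccEquiv R (n + 1)).symm.toAlgHom

theorem shearPoly_apply (p : (MvPolynomial (Fin (n + 1)) R)[X]) :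
    shearPoly p =
      substMonomialsPoly (shearEmb n) ((MvPolynomial.finSuccEquiv R (n + 1)).symm p) :=
  rfl

theorem coeff_cons_finSuccEquiv_symm_polynomial (p : (MvPolynomial (Fin n) R)[X]) (k : ℕ)
    (u : Fin n →₀ ℕ) :
    MvPolynomial.coeff (u.cons k) ((MvPolynomial.finSuccEquiv R n).symm p) =
      MvPolynomial.coeff u (p.coeff k) := by
  rw [← MvPolynomial.finSuccEquiv_coeff_coeff, AlgEquiv.apply_symm_apply]

theorem coe_shearPoly (p : (MvPolynomial (Fin (n + 1)) R)[X]) :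
    (shearPoly p : MvPowerSeries (Fin (n + 1 + 1)) R) =
      shearSubst ↑(p.map (algebraMap _ (MvPowerSeries (Fin (n + 1)) R))) := by
  rw [shearPoly_apply, coe_substMonomialsPoly _ shearEmb_injective, shearSubst_apply]
  congr 1
  ext e
  rw [← Finsupp.cons_tail e, MvPolynomial.coeff_coe, coeff_cons_finSuccEquiv_symm_polynomial,
    coeff_cons_finSuccEquiv_symm, Polynomial.coeff_coe, Polynomial.coeff_map,
    algebraMap_mvPowerSeries_apply, MvPolynomial.coeff_coe]

theorem finSuccEquiv_monomial (e : Fin (n + 1) →₀ ℕ) (r : R) :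
    MvPolynomial.finSuccEquiv R n (MvPolynomial.monomial e r) =
      Polynomial.monomial (e 0) (MvPolynomial.monomial e.tail r) := by
  classical
  ext k u
  rw [MvPolynomial.finSuccEquiv_coeff_coeff, MvPolynomial.coeff_monomial,
    Polynomial.coeff_monomial]
  have h : e = u.cons k ↔ e 0 = k ∧ e.tail = u := by
    rw [← Finsupp.cons_tail e, Finsupp.cons_injective2.eq_iff]
    simp
  grind [MvPolynomial.coeff_monomial, MvPolynomial.coeff_zero]

theorem shearPoly_X :
    shearPoly Polynomial.X = (MvPolynomial.X 0 : MvPolynomial (Fin (n + 1 + 1)) R) := by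
  rw [shearPoly_apply, ← MvPolynomial.finSuccEquiv_X_zero, AlgEquiv.symm_apply_apply,
    MvPolynomial.X, substMonomialsPoly_monomial]
  congr 1
  simp [shearEmb]

-- In terms of series: `y ^ m * P (y, x₀ / y, x₁, …, xₙ)` is a polynomial in `y`.
theorem exists_X_pow_mul_eq_shearPoly (P : MvPolynomial (Fin (n + 1 + 1)) R) :
    ∃ (m : ℕ) (D : (MvPolynomial (Fin (n + 1)) R)[X]),
      MvPolynomial.X 0 ^ m * P = shearPoly D := by
  induction P using MvPolynomial.induction_on' with
  | monomial e r =>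
    refine ⟨e 1, Polynomial.monomial (e 0) (MvPolynomial.monomial e.tail r), ?_⟩
    rw [shearPoly_apply, ← finSuccEquiv_monomial, AlgEquiv.symm_apply_apply,
      substMonomialsPoly_monomial, MvPolynomial.X_pow_eq_monomial, MvPolynomial.monomial_mul,
      one_mul, add_comm (Finsupp.single 0 (e 1)) e]
    rfl
  | add P P' h h' =>
    obtain ⟨m, D, hD⟩ := h
    obtain ⟨m', D', hD'⟩ := h'
    refine ⟨m + m', Polynomial.X ^ m' * D + Polynomial.X ^ m * D', ?_⟩
    rw [map_add, map_mul, map_mul, map_pow, map_pow, shearPoly_X, ← hD, ← hD']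
    ring

theorem shearSubst_C_X_zero :
    shearSubst (PowerSeries.C (MvPowerSeries.X 0 : MvPowerSeries (Fin (n + 1)) R)) =
      MvPowerSeries.X 0 * MvPowerSeries.X 1 := by
  rw [shearSubst_apply, ← MvPowerSeries.finSuccEquiv_X_succ, AlgEquiv.symm_apply_apply,
    substMonomials_X, MvPowerSeries.X, MvPowerSeries.X, MvPowerSeries.monomial_mul_monomial,
    one_mul]
  congr 1
  simp [shearEmb, add_comm]

theorem constantCoeff_yCoeff_zero {R : Type*} [Semiring R]
    (h : MvPowerSeries (Fin (n + 1 + 1)) R) :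
    MvPowerSeries.constantCoeff (yCoeff 0 h) = MvPowerSeries.constantCoeff h := by
  rw [← MvPowerSeries.coeff_zero_eq_constantCoeff_apply, coeff_yCoeff]
  simp

theorem constantCoeff_shearSubst (w : PowerSeries (MvPowerSeries (Fin (n + 1)) R)) :
    MvPowerSeries.constantCoeff (shearSubst w) =
      MvPowerSeries.constantCoeff (PowerSeries.constantCoeff w) := by
  rw [← constantCoeff_yCoeff_zero, yCoeff_shearSubst,
    PowerSeries.coeff_zero_eq_constantCoeff_apply]

end ShearPolynomials

section Furstenberg

variable {n : ℕ} {K : Type*} [Field K]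

theorem exists_isRegularRational_mul_eq {P Q : MvPolynomial (Fin (n + 1)) K}
    (hQ : MvPolynomial.constantCoeff Q ≠ 0) :
    ∃ h : MvPowerSeries (Fin (n + 1)) K, IsRegularRational h ∧ Q * h = P := by
  have hunit : MvPowerSeries.constantCoeff (Q : MvPowerSeries (Fin (n + 1)) K) ≠ 0 := by
    rwa [← algebraMap_mvPowerSeries_apply, constantCoeff_algebraMap_mvPowerSeries]
  have h : (Q : MvPowerSeries (Fin (n + 1)) K) * ((↑Q)⁻¹ * P) = P := by
    rw [← mul_assoc, MvPowerSeries.mul_inv_cancel _ hunit, one_mul]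
  exact ⟨_, ⟨P, Q, hQ, h⟩, h⟩

theorem exists_coe_eq_of_coe_eq_monomial_mul {R σ : Type*} [CommSemiring R] {P : MvPolynomial σ R}
    {c : σ →₀ ℕ} {w : MvPowerSeries σ R}
    (h : (P : MvPowerSeries σ R) = MvPowerSeries.monomial c 1 * w) :
    ∃ Q : MvPolynomial σ R, (Q : MvPowerSeries σ R) = w := by
  obtain ⟨Q, hQ⟩ := exists_coe_eq_pullback (φ := AddMonoidHom.id (σ →₀ ℕ)) Function.injective_id
    c P
  refine ⟨Q, hQ.trans ?_⟩
  ext u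
  rw [coeff_pullback, h, AddMonoidHom.id_apply, add_comm, MvPowerSeries.coeff_add_monomial_mul,
    one_mul]

theorem constantCoeff_coeff_zero_of_mul_eq {R : Type*} [CommRing R] {n : ℕ}
    {U F : (MvPowerSeries (Fin n) R)[X]} {z : MvPowerSeries (Fin n) R}
    (hz : MvPowerSeries.constantCoeff z = 0) (hU : F = (Polynomial.X - Polynomial.C z) * U) :
    MvPowerSeries.constantCoeff (U.coeff 0) = MvPowerSeries.constantCoeff (F.coeff 1) := by
  simp [hU, sub_mul, Polynomial.coeff_X_mul, hz]

theorem isDistinguishedAt_X_sub_C {R : Type*} [CommRing R] {I : Ideal R} {z : R} (hz : z ∈ I) :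
    (Polynomial.X - Polynomial.C z).IsDistinguishedAt I := by
  refine ⟨⟨fun {k} hk => ?_⟩, Polynomial.monic_X_sub_C z⟩
  obtain rfl : k = 0 := Nat.lt_one_iff.1 (hk.trans_le (Polynomial.natDegree_X_sub_C_le z))
  simpa using hz

-- Furstenberg's formula: if `H (y, x₀ / y, x₁, …, xₙ) = y ^ 2 * F' / F`, then its coefficient of
-- `y ^ 0` is the residue of `y * F' / F` at the simple root, which is the root itself.
theorem exists_isRegularRational_yCoeff_eq_of_simple_root
    {F : (MvPolynomial (Fin (n + 1)) K)[X]} {ζ : MvPowerSeries (Fin (n + 1)) K}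
    (hF : Polynomial.aeval (MvPowerSeries.X 0 * ζ) F = 0)
    (hF' : MvPolynomial.constantCoeff (F.coeff 1) ≠ 0) :
    ∃ H : MvPowerSeries (Fin (n + 1 + 1)) K, IsRegularRational H ∧
      yCoeff 0 H = MvPowerSeries.X 0 * ζ := by
  set z : MvPowerSeries (Fin (n + 1)) K := MvPowerSeries.X 0 * ζ with hz
  set S := Polynomial.X - Polynomial.C z with hS
  obtain ⟨U, hU⟩ : S ∣ F.map (algebraMap _ _) := by
    rwa [Polynomial.dvd_iff_isRoot, Polynomial.IsRoot.def, Polynomial.eval_map_algebraMap]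
  have hU0 : MvPowerSeries.constantCoeff (U.coeff 0) ≠ 0 := by
    rwa [constantCoeff_coeff_zero_of_mul_eq (by simp [hz]) hU, Polynomial.coeff_map,
      constantCoeff_algebraMap_mvPowerSeries]
  have hshear : (shearPoly F : MvPowerSeries (Fin (n + 1 + 1)) K) = MvPowerSeries.X 0 *
      ((1 - MvPowerSeries.X 1 * shearSubst (PowerSeries.C ζ)) * shearSubst U) := by
    rw [coe_shearPoly, hU, Polynomial.coe_mul, map_mul, hS, Polynomial.coe_sub, map_sub,
      Polynomial.coe_X, Polynomial.coe_C, shearSubst_X, hz, map_mul, map_mul, shearSubst_C_X_zero]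
    ring
  obtain ⟨Q, hQ⟩ := exists_coe_eq_of_coe_eq_monomial_mul hshear
  have hQ0 : MvPolynomial.constantCoeff Q ≠ 0 := by
    rw [← constantCoeff_algebraMap_mvPowerSeries, algebraMap_mvPowerSeries_apply, hQ, map_mul,
      constantCoeff_shearSubst]
    simpa using hU0
  obtain ⟨H, hH, hQH⟩ := exists_isRegularRational_mul_eq
    (P := MvPolynomial.X 0 * shearPoly (Polynomial.derivative F)) hQ0
  refine ⟨H, hH, ?_⟩
  have hUunit : IsUnit (U.coeff 0) := MvPowerSeries.isUnit_iff_constantCoeff.2 hU0.isUnit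
  have hdist : S.IsDistinguishedAt (Ideal.span (Set.range MvPowerSeries.X)) :=
    isDistinguishedAt_X_sub_C (Ideal.mul_mem_right _ _ (Ideal.subset_span ⟨0, rfl⟩))
  have hres : U.coeff 0 * yCoeff 0 H = ((Polynomial.X + Polynomial.C z) * U +
      Polynomial.X ^ 2 * Polynomial.derivative U).coeff 0 := by
    refine coeff_zero_mul_yCoeff_zero_of_shearSubst_mul_eq (r := Polynomial.C (z ^ 2)) hdist
      hUunit ?_ ?_
    · rw [hS, Polynomial.degree_X_sub_C]
      exact Polynomial.degree_C_le.trans_lt one_pos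
    · rw [← hU, ← coe_shearPoly, hshear, mul_assoc, ← hQ, hQH, MvPolynomial.coe_mul,
        coe_shearPoly, ← Polynomial.derivative_map, hU, MvPolynomial.coe_X, ← shearSubst_X,
        ← map_mul, ← map_mul, ← Polynomial.coe_X, ← Polynomial.coe_mul, ← Polynomial.coe_mul, hS]
      congr 2
      simp only [Polynomial.derivative_mul, Polynomial.derivative_sub, Polynomial.derivative_X,
        Polynomial.derivative_C, map_pow]
      ring
  refine hUunit.mul_left_cancel ?_
  simp [hres, mul_comm]

end Furstenberg

section Weights

-- The lexicographically least element of `S` is isolated by weights that decrease fast enough.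
theorem exists_weight_lt : ∀ {n : ℕ} {S : Set (Fin n →₀ ℕ)}, S.Nonempty →
    ∃ v ∈ S, ∃ w : Fin n → ℕ, (∀ i, 0 < w i) ∧
      ∀ u ∈ S, u ≠ v → Finsupp.weight w v < Finsupp.weight w u
  | 0, _, ⟨v, hv⟩ => ⟨v, hv, 0, (·.elim0), fun u _ h => (h (Subsingleton.elim u v)).elim⟩
  | n + 1, S, hS => by
    obtain ⟨u₀, hu₀, hmin⟩ := exists_minimalFor_of_wellFoundedLT (· ∈ S) (fun u => u 0) hS
    obtain ⟨v, hv, w, hw, hvw⟩ := exists_weight_lt (S := {t | t.cons (u₀ 0) ∈ S})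
      ⟨u₀.tail, by simpa using hu₀⟩
    refine ⟨v.cons (u₀ 0), hv, Fin.cons (Finsupp.weight w v + 1) w, ?_, fun u hu huv => ?_⟩
    · exact Fin.cases (Nat.succ_pos _) hw
    · have hcons (a : ℕ) (t : Fin n →₀ ℕ) :
          Finsupp.weight (Fin.cons (Finsupp.weight w v + 1) w : Fin (n + 1) → ℕ) (t.cons a) =
            a * (Finsupp.weight w v + 1) + Finsupp.weight w t := by
        simp [Finsupp.weight_eq_sum, Fin.sum_univ_succ]
      rw [← u.cons_tail, hcons, hcons]
      obtain h | h : u₀ 0 = u 0 ∨ u₀ 0 < u 0 :=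
        ((le_total (u 0) (u₀ 0)).elim (hmin hu) id).eq_or_lt
      · rw [h]
        refine Nat.add_lt_add_left (hvw u.tail ?_ ?_) _
        · simpa [h] using hu
        · rintro rfl
          exact huv (by rw [h, u.cons_tail])
      · nlinarith

theorem exists_add_weight_le {n : ℕ} {S : Set (Fin n →₀ ℕ)} (hS : S.Nonempty) :
    ∃ v ∈ S, ∃ w : Fin n → ℕ, (∀ i, 0 < w i) ∧
      ∀ u ∈ S, ∀ j, v j + Finsupp.weight w v ≤ u j + Finsupp.weight w u := by
  obtain ⟨v, hv, w, hw, h⟩ := exists_weight_lt hS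
  refine ⟨v, hv, fun i => (v.degree + 1) * w i, fun i => Nat.mul_pos (Nat.succ_pos _) (hw i),
    fun u hu j => ?_⟩
  obtain rfl | huv := eq_or_ne u v
  · rfl
  · have hscale (t : Fin n →₀ ℕ) : Finsupp.weight (fun i => (v.degree + 1) * w i) t =
        (v.degree + 1) * Finsupp.weight w t := by
      simp only [Finsupp.weight_eq_sum, smul_eq_mul, Finset.mul_sum, mul_left_comm]
    have hlt := Nat.mul_le_mul_left (v.degree + 1) (h u hu huv)
    have hdeg : v j ≤ v.degree := Finsupp.le_degree j v
    rw [hscale, hscale]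
    linarith

variable {σ : Type*} [Fintype σ] (w : σ → ℕ)

/-- The effect on exponents of the substitution of `t i * (∏ j, t j) ^ w i` for `t i`, which turns
a series into one whose nonzero coefficients are far from the coordinate hyperplanes. -/
def weightEmb : (σ →₀ ℕ) →+ (σ →₀ ℕ) :=
  AddMonoidHom.id _ +
    (multiplesHom _ (Finsupp.equivFunOnFinite.symm fun _ => 1)).comp (Finsupp.weight w)

theorem weightEmb_eq (u : σ →₀ ℕ) :
    weightEmb w u = u + Finsupp.weight w u • Finsupp.equivFunOnFinite.symm fun _ => 1 :=
  rfl

theorem weightEmb_apply (u : σ →₀ ℕ) (j : σ) : weightEmb w u j = u j + Finsupp.weight w u := by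
  simp [weightEmb_eq]

theorem weight_const (i : ℕ) :
    Finsupp.weight w (Finsupp.equivFunOnFinite.symm fun _ => i) = i * ∑ j, w j := by
  simp [Finsupp.weight_eq_sum, Finset.mul_sum]

theorem weightEmb_injective : Function.Injective (weightEmb w) := fun u v h => by
  have hw (t : σ →₀ ℕ) : Finsupp.weight w (weightEmb w t) =
      Finsupp.weight w t * (1 + ∑ j, w j) := by
    simp [weightEmb_eq, weight_const, mul_add]
  have huv : Finsupp.weight w u = Finsupp.weight w v :=
    Nat.eq_of_mul_eq_mul_right (Nat.add_pos_left one_pos _) (by rw [← hw, ← hw, h])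
  rwa [weightEmb_eq, weightEmb_eq, huv, add_left_inj] at h

theorem weightEmb_const (i : ℕ) :
    weightEmb w (Finsupp.equivFunOnFinite.symm fun _ => i) =
      (1 + ∑ j, w j) • Finsupp.equivFunOnFinite.symm fun _ => i := by
  ext j
  simp [weightEmb_apply, weight_const, mul_add, mul_comm]

variable {w}

theorem degree_le_weightEmb (hw : ∀ i, 0 < w i) (u : σ →₀ ℕ) (j : σ) :
    u.degree ≤ weightEmb w u j := by
  rw [weightEmb_apply, Finsupp.degree_eq_sum, Finsupp.weight_eq_sum]
  exact le_add_left (Finset.sum_le_sum fun i _ => Nat.le_mul_of_pos_right _ (hw i))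

end Weights

section MonomialFactor

theorem exists_eq_monomial_mul {σ R : Type*} [Semiring R] {f : MvPowerSeries σ R} {c : σ →₀ ℕ}
    (hf : ∀ e, MvPowerSeries.coeff e f ≠ 0 → c ≤ e) :
    ∃ g : MvPowerSeries σ R, f = MvPowerSeries.monomial c 1 * g := by
  classical
  refine ⟨pullback (AddMonoidHom.id _) c f, MvPowerSeries.ext fun e => ?_⟩
  rw [MvPowerSeries.coeff_monomial_mul]
  split_ifs with h
  · rw [one_mul, coeff_pullback, AddMonoidHom.id_apply, tsub_add_cancel_of_le h]
  · exact by_contra fun h0 => h (hf e h0)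

variable {R : Type*} [CommRing R]

theorem exists_substMonomials_weightEmb_eq_monomial_mul {n : ℕ} {f : MvPowerSeries (Fin n) R}
    (hf : f ≠ 0) :
    ∃ w : Fin n → ℕ, (∀ i, 0 < w i) ∧ ∃ (a : Fin n →₀ ℕ) (e : MvPowerSeries (Fin n) R),
      substMonomials (weightEmb w) (weightEmb_injective w) f = MvPowerSeries.monomial a 1 * e ∧
      MvPowerSeries.constantCoeff e ≠ 0 := by
  obtain ⟨v, hv, w, hw, hvw⟩ := exists_add_weight_le (S := {u | MvPowerSeries.coeff u f ≠ 0})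
    (by simpa [Set.Nonempty, MvPowerSeries.ext_iff] using hf)
  obtain ⟨e, he⟩ := exists_eq_monomial_mul
    (f := substMonomials (weightEmb w) (weightEmb_injective w) f) (c := weightEmb w v) (by
      intro e he j
      obtain ⟨u, rfl, hu⟩ := exists_of_coeff_substMonomials_ne_zero _ _ he
      simpa only [weightEmb_apply] using hvw u hu j)
  refine ⟨w, hw, weightEmb w v, e, he, ?_⟩
  have hcoeff := congrArg (MvPowerSeries.coeff (weightEmb w v + 0)) he
  rw [MvPowerSeries.coeff_add_monomial_mul, one_mul, add_zero, coeff_substMonomials,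
    MvPowerSeries.coeff_zero_eq_constantCoeff_apply] at hcoeff
  exact hcoeff ▸ hv

theorem exists_substMonomials_weightEmb_eq_coe_add {σ : Type*} [Fintype σ] {w : σ → ℕ}
    (hw : ∀ i, 0 < w i) (f : MvPowerSeries σ R) (c : σ →₀ ℕ) :
    ∃ (T : MvPolynomial σ R) (z : MvPowerSeries σ R),
      substMonomials (weightEmb w) (weightEmb_injective w) f =
        (T : MvPowerSeries σ R) + MvPowerSeries.monomial c 1 * z := by
  let T : MvPowerSeries σ R := MvPowerSeries.truncTotal c.degree f
  obtain ⟨z, hz⟩ := exists_eq_monomial_mul (c := c)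
    (f := substMonomials (weightEmb w) (weightEmb_injective w) (f - T)) (by
      intro e he j
      obtain ⟨u, rfl, hu⟩ := exists_of_coeff_substMonomials_ne_zero _ _ he
      refine (Finsupp.le_degree j c).trans (le_trans ?_ (degree_le_weightEmb hw u j))
      contrapose! hu
      rw [map_sub, MvPolynomial.coeff_coe, MvPowerSeries.coeff_truncTotal _ hu, sub_self])
  exact ⟨substMonomialsPoly (weightEmb w) (MvPowerSeries.truncTotal c.degree f), z, by
    rw [coe_substMonomialsPoly _ (weightEmb_injective w), ← hz, map_sub, add_sub_cancel]⟩

end MonomialFactor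

section SimpleRoot

theorem exists_aeval_eq_zero_derivative_ne_zero {R A : Type*} [CommRing R] [IsDomain R]
    [CharZero R] [Ring A] [Algebra R A] [FaithfulSMul R A] {g : A} (hg : IsAlgebraic R g) :
    ∃ p : R[X], Polynomial.aeval g p = 0 ∧ Polynomial.aeval g (Polynomial.derivative p) ≠ 0 := by
  obtain ⟨p, ⟨hp, hpg⟩, hmin⟩ := exists_minimalFor_of_wellFoundedLT
    (fun p : R[X] => p ≠ 0 ∧ Polynomial.aeval g p = 0) Polynomial.natDegree hg
  refine ⟨p, hpg, fun h => ?_⟩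
  have hdeg : p.natDegree ≠ 0 := fun h0 => by
    obtain ⟨c, rfl⟩ := Polynomial.natDegree_eq_zero.1 h0
    rw [Polynomial.aeval_C, FaithfulSMul.algebraMap_eq_zero_iff] at hpg
    exact hp (by rw [hpg, map_zero])
  have hlt := Polynomial.natDegree_derivative_lt hdeg
  exact hlt.not_ge (hmin ⟨fun h0 => hdeg (Polynomial.derivative_eq_zero.1 h0), h⟩ hlt.le)

instance {σ R : Type*} [CommSemiring R] :
    FaithfulSMul (MvPolynomial σ R) (MvPowerSeries σ R) :=
  (faithfulSMul_iff_algebraMap_injective _ _).2 fun P Q h =>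
    MvPolynomial.coe_injective _ _ (by
      rwa [algebraMap_mvPowerSeries_apply, algebraMap_mvPowerSeries_apply] at h)

theorem substMonomials_aeval {σ τ R : Type*} [Finite σ] [CommRing R] {φ : (σ →₀ ℕ) →+ (τ →₀ ℕ)}
    (hφ : Function.Injective φ) (g : MvPowerSeries σ R) (p : (MvPolynomial σ R)[X]) :
    substMonomials φ hφ (Polynomial.aeval g p) =
      Polynomial.aeval (substMonomials φ hφ g)
        (p.map (substMonomialsPoly φ).toRingHom) := by
  rw [Polynomial.aeval_def, Polynomial.aeval_def, ← RingHom.coe_coe, Polynomial.hom_eval₂,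
    Polynomial.eval₂_map]
  congr 1
  refine RingHom.ext fun P => ?_
  simp [algebraMap_mvPowerSeries_apply, coe_substMonomialsPoly φ hφ]

theorem exists_aeval_algebraMap_add_mul_eq {R A : Type*} [CommRing R] [CommRing A] [Algebra R A]
    (q : R[X]) (x y : R) :
    ∃ k : R[X], ∀ z : A, Polynomial.aeval (algebraMap R A x + algebraMap R A y * z) q =
      algebraMap R A (q.eval x) + algebraMap R A (q.derivative.eval x) * (algebraMap R A y * z) +
        Polynomial.aeval z k * (algebraMap R A y * z) ^ 2 := by
  obtain ⟨k, hk⟩ := (q.map Polynomial.C).binomExpansion (Polynomial.C x)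
    (Polynomial.C y * Polynomial.X)
  refine ⟨k, fun z => ?_⟩
  rw [Polynomial.derivative_map, Polynomial.eval_map, Polynomial.eval_map, Polynomial.eval_map,
    Polynomial.eval₂_hom, Polynomial.eval₂_hom] at hk
  change q.comp _ = _ at hk
  simpa [Polynomial.aeval_comp] using congrArg (Polynomial.aeval z) hk

theorem exists_eval_eq_monomial_mul {σ R : Type*} [CommRing R] {q : (MvPolynomial σ R)[X]}
    {T : MvPolynomial σ R} {a s : σ →₀ ℕ} (hs : s ≠ 0) {g z e : MvPowerSeries σ R}
    (hg : g = (T : MvPowerSeries σ R) + MvPowerSeries.monomial (a + s) 1 * z)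
    (hq : Polynomial.aeval g q = MvPowerSeries.monomial a 1 * e) :
    ∃ p : MvPolynomial σ R, q.eval T = MvPolynomial.monomial a 1 * p ∧
      MvPolynomial.constantCoeff p = MvPowerSeries.constantCoeff e := by
  classical
  obtain ⟨r, hr⟩ : g - T ∣ Polynomial.aeval g q - Polynomial.aeval (T : MvPowerSeries σ R) q := by
    simpa only [Polynomial.eval_map_algebraMap] using
      Polynomial.sub_dvd_eval_sub g T (q.map (algebraMap _ _))
  have hT : ((q.eval T : MvPolynomial σ R) : MvPowerSeries σ R) =
      MvPowerSeries.monomial a 1 * (e - MvPowerSeries.monomial s 1 * z * r) := by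
    have hmul : (MvPowerSeries.monomial (a + s) 1 : MvPowerSeries σ R) =
        MvPowerSeries.monomial a 1 * MvPowerSeries.monomial s 1 := by
      rw [MvPowerSeries.monomial_mul_monomial, one_mul]
    rw [← algebraMap_mvPowerSeries_apply T, Polynomial.aeval_algebraMap_apply_eq_algebraMap_eval,
      algebraMap_mvPowerSeries_apply, algebraMap_mvPowerSeries_apply, hq, hg, hmul] at hr
    linear_combination -hr
  obtain ⟨p, hp⟩ := exists_coe_eq_of_coe_eq_monomial_mul hT
  refine ⟨p, MvPolynomial.coe_injective _ _ ?_, ?_⟩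
  · rw [hT, MvPolynomial.coe_mul, MvPolynomial.coe_monomial, hp]
  · have hms : MvPowerSeries.constantCoeff (MvPowerSeries.monomial s (1 : R)) = 0 := by
      rw [← MvPowerSeries.coeff_zero_eq_constantCoeff_apply, MvPowerSeries.coeff_monomial,
        if_neg hs.symm]
    rw [← constantCoeff_algebraMap_mvPowerSeries, algebraMap_mvPowerSeries_apply, hp, map_sub,
      map_mul, map_mul, hms, zero_mul, zero_mul, sub_zero]

-- Newton's lemma: after division by `t ^ (2 * a + s)`, the Taylor expansion of `q` at `T` becomes
-- an equation for `z` whose linear coefficient is a unit and whose quadratic one vanishes at `0`.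
theorem exists_simple_root_of_aeval_derivative_eq {σ R : Type*} [CommRing R]
    {q : (MvPolynomial σ R)[X]} {T : MvPolynomial σ R} {a s : σ →₀ ℕ} (hs : s ≠ 0)
    {g z e : MvPowerSeries σ R}
    (hg : g = (T : MvPowerSeries σ R) + MvPowerSeries.monomial (a + s) 1 * z)
    (hq : Polynomial.aeval g q = 0)
    (hq' : Polynomial.aeval g (Polynomial.derivative q) = MvPowerSeries.monomial a 1 * e)
    (he : MvPowerSeries.constantCoeff e ≠ 0) :
    ∃ F : (MvPolynomial σ R)[X], Polynomial.aeval z F = 0 ∧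
      MvPolynomial.constantCoeff (F.coeff 1) ≠ 0 := by
  have hm (c c' : σ →₀ ℕ) : (MvPowerSeries.monomial (c + c') 1 : MvPowerSeries σ R) =
      MvPowerSeries.monomial c 1 * MvPowerSeries.monomial c' 1 := by
    rw [MvPowerSeries.monomial_mul_monomial, one_mul]
  obtain ⟨p₁, hp₁, hp₁e⟩ := exists_eval_eq_monomial_mul hs hg hq'
  obtain ⟨k, hk⟩ := exists_aeval_algebraMap_add_mul_eq (A := MvPowerSeries σ R) q T
    (MvPolynomial.monomial (a + s) 1)
  replace hk := hk z
  simp only [algebraMap_mvPowerSeries_apply, MvPolynomial.coe_monomial, ← hg, hq, hp₁,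
    MvPolynomial.coe_mul] at hk
  obtain ⟨p₀, hp₀⟩ : ∃ p₀ : MvPolynomial σ R, (p₀ : MvPowerSeries σ R) =
      -((p₁ : MvPowerSeries σ R) * z +
        MvPowerSeries.monomial s 1 * Polynomial.aeval z k * z ^ 2) := by
    refine exists_coe_eq_of_coe_eq_monomial_mul (P := q.eval T) (c := a + (a + s)) ?_
    rw [hm] at hk ⊢
    rw [hm]
    linear_combination -hk
  refine ⟨Polynomial.C p₀ + Polynomial.C p₁ * Polynomial.X +
    Polynomial.C (MvPolynomial.monomial s 1) * k * Polynomial.X ^ 2, ?_, ?_⟩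
  · simp only [map_add, map_mul, map_pow, Polynomial.aeval_C, Polynomial.aeval_X,
      algebraMap_mvPowerSeries_apply, MvPolynomial.coe_monomial, hp₀]
    ring
  · simpa [Polynomial.coeff_mul_X_pow', hp₁e] using he

theorem exists_simple_root_of_isAlgebraicSeries {K : Type*} [Field K] [CharZero K] {n : ℕ}
    {g : MvPowerSeries (Fin (n + 1)) K} (hg : IsAlgebraicSeries g) :
    ∃ (w : Fin (n + 1) → ℕ) (T B : MvPolynomial (Fin (n + 1)) K)
      (ζ : MvPowerSeries (Fin (n + 1)) K) (F : (MvPolynomial (Fin (n + 1)) K)[X]),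
      substMonomials (weightEmb w) (weightEmb_injective w) g =
        (T : MvPowerSeries (Fin (n + 1)) K) +
          (B : MvPowerSeries (Fin (n + 1)) K) * (MvPowerSeries.X 0 * ζ) ∧
      Polynomial.aeval (MvPowerSeries.X 0 * ζ) F = 0 ∧
      MvPolynomial.constantCoeff (F.coeff 1) ≠ 0 := by
  obtain ⟨p, hp, hp'⟩ := exists_aeval_eq_zero_derivative_ne_zero hg
  obtain ⟨w, hw, a, e, he, he0⟩ := exists_substMonomials_weightEmb_eq_monomial_mul hp'
  let s : Fin (n + 1) →₀ ℕ := Finsupp.single 0 1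
  obtain ⟨T, ζ, hT⟩ := exists_substMonomials_weightEmb_eq_coe_add hw g (a + s + s)
  rw [← mul_one (1 : K), ← MvPowerSeries.monomial_mul_monomial, mul_assoc] at hT
  obtain ⟨F, hF, hF'⟩ := exists_simple_root_of_aeval_derivative_eq (by simp [s]) hT
    (by rw [← substMonomials_aeval, hp, map_zero])
    (by rw [Polynomial.derivative_map, ← substMonomials_aeval, he]) he0
  refine ⟨w, T, MvPolynomial.monomial (a + s) 1, ζ, F, ?_, hF, hF'⟩
  rw [hT, MvPolynomial.coe_monomial, MvPowerSeries.X]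

theorem exists_isRegularRational_diagonal_eq {K : Type*} [Field K] [CharZero K] {n : ℕ}
    {g : MvPowerSeries (Fin (n + 1)) K} (hg : IsAlgebraicSeries g) :
    ∃ h : MvPowerSeries (Fin (n + 1 + 1)) K, IsRegularRational h ∧ diagonal g = diagonal h := by
  obtain ⟨w, T, B, ζ, F, hT, hF, hF'⟩ := exists_simple_root_of_isAlgebraicSeries hg
  obtain ⟨H, hH, hHζ⟩ := exists_isRegularRational_yCoeff_eq_of_simple_root hF hF'
  have hreg := hH.coe_add_coe_mul (shearPoly (Polynomial.C T)) (shearPoly (Polynomial.C B))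
  set H' := (shearPoly (Polynomial.C T) : MvPowerSeries (Fin (n + 1 + 1)) K) +
    shearPoly (Polynomial.C B) * H with hH'
  have hy : yCoeff 0 H' = substMonomials (weightEmb w) (weightEmb_injective w) g := by
    rw [hH', map_add, coe_shearPoly, coe_shearPoly, yCoeff_shearSubst, Polynomial.map_C,
      Polynomial.map_C, Polynomial.coe_C, Polynomial.coe_C, yCoeff_shearSubst_C_mul, hHζ, hT,
      algebraMap_mvPowerSeries_apply, algebraMap_mvPowerSeries_apply, PowerSeries.coeff_zero_C]
  have hd : 1 + ∑ i, w i ≠ 0 := by positivity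
  refine ⟨multisection (1 + ∑ i, w i) H', hreg.multisection hd, ?_⟩
  ext i
  have hdiag := congrArg (PowerSeries.coeff ((1 + ∑ i, w i) * i)) (diagonal_yCoeff_zero H')
  simp only [diagonal, PowerSeries.coeff_mk, coeff_multisection, hy] at hdiag ⊢
  have hconst (k : ℕ) : (1 + ∑ i, w i) • (Finsupp.equivFunOnFinite.symm fun _ : Fin k => i) =
      Finsupp.equivFunOnFinite.symm fun _ => (1 + ∑ i, w i) * i := by
    ext
    simp
  rw [hconst, ← hdiag, ← hconst, ← weightEmb_const, coeff_substMonomials]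

end SimpleRoot

section Weierstrass

open IsLocalRing

variable {A : Type*} [CommRing A]

theorem exists_coe_eq_of_coe_mul_eq_coe {I : Ideal A} [IsHausdorff I A] {S D : A[X]}
    (hS : S.IsDistinguishedAt I) {h : PowerSeries A} (hD : (S : PowerSeries A) * h = D) :
    ∃ L : A[X], (L : PowerSeries A) = h := by
  rcases eq_or_ne I ⊤ with rfl | hI
  · have : Subsingleton A := IsHausdorff.subsingleton ‹_›
    exact ⟨0, Subsingleton.elim _ _⟩
  have := Ideal.Quotient.nontrivial_iff.2 hI
  have : Nontrivial A := (Ideal.Quotient.mk I).domain_nontrivial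
  have hdeg (r : A[X]) (hr : r.degree < S.degree) :
      r.degree < ((S : PowerSeries A).map (Ideal.Quotient.mk I)).order.toNat := by
    have hfact : (S : PowerSeries A).IsWeierstrassFactorizationAt S 1 I :=
      ⟨hS, isUnit_one, (mul_one _).symm⟩
    rwa [← hfact.natDegree_eq_toNat_order_map_of_ne_top hI,
      ← Polynomial.degree_eq_natDegree hS.monic.ne_zero]
  refine ⟨D /ₘ S, (hS.isWeierstrassDivisorAt'.eq_of_mul_add_eq_mul_add
    (hdeg _ (Polynomial.degree_modByMonic_lt D hS.monic)) (hdeg 0 ?_) ?_).1⟩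
  · rw [Polynomial.degree_zero, bot_lt_iff_ne_bot, Polynomial.degree_ne_bot]
    exact hS.monic.ne_zero
  · rw [Polynomial.coe_zero, add_zero, hD, ← Polynomial.coe_mul, ← Polynomial.coe_add, add_comm,
      Polynomial.modByMonic_add_div]

theorem exists_isDistinguishedAt_mul [IsLocalRing A] [IsAdicComplete (maximalIdeal A) A] {D : A[X]}
    {m : ℕ} (hm : IsUnit (D.coeff m)) :
    ∃ S L : A[X], S.IsDistinguishedAt (maximalIdeal A) ∧ IsUnit (L.coeff 0) ∧ D = S * L := by
  have hD : (D : PowerSeries A).map (residue A) ≠ 0 := fun h0 => by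
    have h0m := congrArg (PowerSeries.coeff m) h0
    rw [PowerSeries.coeff_map, Polynomial.coeff_coe, map_zero, residue_eq_zero_iff] at h0m
    exact h0m hm
  obtain ⟨S, h, hS, hunit, hSh⟩ := PowerSeries.exists_isWeierstrassFactorization hD
  obtain ⟨L, rfl⟩ := exists_coe_eq_of_coe_mul_eq_coe hS hSh.symm
  refine ⟨S, L, hS, ?_, mod_cast hSh⟩
  rwa [PowerSeries.isUnit_iff_constantCoeff, Polynomial.constantCoeff_coe] at hunit

theorem isCoprime_of_isDistinguishedAt [IsLocalRing A] {S L : A[X]}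
    (hS : S.IsDistinguishedAt (maximalIdeal A)) (hL : IsUnit (L.coeff 0)) : IsCoprime S L := by
  have hSX : S.map (residue A) = Polynomial.X ^ S.natDegree := hS.map_eq_X_pow
  rw [← Polynomial.isUnit_resultant_iff_isCoprime hS.monic, ← residue_ne_zero_iff_isUnit,
    ← Polynomial.resultant_map_map, hSX,
    Polynomial.resultant_X_pow_left _ _ _ Polynomial.natDegree_map_le, Polynomial.coeff_map]
  exact pow_ne_zero _ ((residue_ne_zero_iff_isUnit _).2 hL)

end Weierstrass

section AlgebraicClosure

open IsLocalRing

variable {R A : Type*} [CommRing R] [IsDomain R] [CommRing A] [Algebra R A]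

theorem isAlgebraic_coeff_of_dvd [IsDomain A] [FaithfulSMul R A] {D : R[X]} (hD : D ≠ 0) {S : A[X]}
    (hS : S.Monic) (hdvd : S ∣ D.map (algebraMap R A)) (i : ℕ) : IsAlgebraic R (S.coeff i) := by
  classical
  let F := FractionRing R
  let E := FractionRing A
  let := FractionRing.liftAlgebra R E
  have hDF : D.map (algebraMap R F) ≠ 0 :=
    (Polynomial.map_ne_zero_iff (IsFractionRing.injective R F)).2 hD
  have hdvdE : S.map (algebraMap A E) ∣
      (normalize (D.map (algebraMap R F))).map (algebraMap F E) := by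
    refine dvd_trans ?_ (Polynomial.map_dvd _ (normalize_associated _).symm.dvd)
    rw [Polynomial.map_map, ← IsScalarTower.algebraMap_eq, IsScalarTower.algebraMap_eq R A E,
      ← Polynomial.map_map]
    exact Polynomial.map_dvd _ hdvd
  have hint := Polynomial.isIntegral_coeff_of_dvd _ _ (Polynomial.monic_normalize hDF)
    (hS.map (algebraMap A E)) hdvdE i
  rw [Polynomial.coeff_map] at hint
  have halg := (IsFractionRing.isAlgebraic_iff R F E).2 hint.isAlgebraic
  exact (isAlgebraic_algebraMap_iff (IsFractionRing.injective A E)).1 halg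

instance isLocalHom_algebraicClosure_val :
    IsLocalHom (Subalgebra.algebraicClosure R A).val.toRingHom where
  map_nonunit a ha := by
    let : Invertible (a : A) := ha.invertible
    exact IsUnit.of_mul_eq_one ⟨⅟(a : A), IsAlgebraic.invOf a.2⟩ (Subtype.ext (mul_invOf_self _))

instance isLocalRing_algebraicClosure [IsLocalRing A] :
    IsLocalRing (Subalgebra.algebraicClosure R A) :=
  (Subalgebra.algebraicClosure R A).val.toRingHom.domain_isLocalRing

theorem exists_isDistinguishedAt_mul_algebraicClosure [IsDomain A] [FaithfulSMul R A]
    [IsLocalRing A] [IsAdicComplete (maximalIdeal A) A] {D : R[X]} {m : ℕ}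
    (hm : IsUnit (algebraMap R A (D.coeff m))) :
    ∃ S L : (Subalgebra.algebraicClosure R A)[X],
      S.IsDistinguishedAt (maximalIdeal (Subalgebra.algebraicClosure R A)) ∧
        IsUnit (L.coeff 0) ∧
        D.map (algebraMap R (Subalgebra.algebraicClosure R A)) = S * L := by
  let ι := (Subalgebra.algebraicClosure R A).val.toRingHom
  have hι : Function.Injective ι := Subtype.val_injective
  have hD : D ≠ 0 := by
    rintro rfl
    simp at hm
  obtain ⟨S, L, hS, hL, hSL⟩ := exists_isDistinguishedAt_mul
    (D := D.map (algebraMap R A)) (m := m) (by rwa [Polynomial.coeff_map])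
  obtain ⟨S, rfl⟩ : S ∈ Polynomial.lifts ι := (Polynomial.lifts_iff_coeff_lifts _).2 fun i =>
    ⟨⟨_, isAlgebraic_coeff_of_dvd hD hS.monic ⟨L, hSL⟩ i⟩, rfl⟩
  rw [Polynomial.coe_mapRingHom] at hS hSL
  have hSm : S.Monic := Polynomial.monic_of_injective hι hS.monic
  have hDι : D.map (algebraMap R A) =
      (D.map (algebraMap R (Subalgebra.algebraicClosure R A))).map ι := by
    rw [Polynomial.map_map]
    rfl
  obtain ⟨L', hL'⟩ : S ∣ D.map (algebraMap R (Subalgebra.algebraicClosure R A)) :=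
    (Polynomial.map_dvd_map ι hι hSm).1 ⟨L, hDι ▸ hSL⟩
  have hLL' : L'.map ι = L := hS.monic.isRegular.left <| by
    simp only [← hSL, hDι, hL', Polynomial.map_mul]
  refine ⟨S, L', ⟨⟨fun {i} hi => ?_⟩, hSm⟩, ?_, hL'⟩
  · have := hS.mem (n := i) (by rwa [hSm.natDegree_map])
    rw [Polynomial.coeff_map] at this
    exact fun hunit => this (hunit.map ι)
  · rw [← hLL', Polynomial.coeff_map] at hL
    exact isUnit_of_map_unit ι _ hL

end AlgebraicClosure

section MaximalIdeal

variable {σ K : Type*}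

theorem mem_span_X_image_of_coeff_eq_zero {R : Type*} [CommRing R] (s : Finset σ)
    {f : MvPowerSeries σ R} (hf : ∀ u : σ →₀ ℕ, (∀ j ∈ s, u j = 0) → MvPowerSeries.coeff u f = 0) :
    f ∈ Ideal.span (MvPowerSeries.X '' (s : Set σ)) := by
  classical
  induction s using Finset.induction_on generalizing f with
  | empty =>
    rw [(MvPowerSeries.ext fun u => hf u (by simp) : f = 0)]
    exact Ideal.zero_mem _
  | insert j s _ ih =>
    have hcoeff (u : σ →₀ ℕ) := MvPowerSeries.coeff_monomial_mul u (Finsupp.single j 1)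
      (pullback (AddMonoidHom.id _) (Finsupp.single j 1) f) 1
    simp only [one_mul, coeff_pullback, AddMonoidHom.id_apply] at hcoeff
    rw [Finset.coe_insert, Set.image_insert_eq, Ideal.mem_span_insert]
    refine ⟨pullback (AddMonoidHom.id _) (Finsupp.single j 1) f, f - _, ih fun u hu => ?_,
      (add_sub_cancel _ f).symm⟩
    rw [map_sub, mul_comm, MvPowerSeries.X_def, hcoeff]
    split_ifs with hj
    · rw [tsub_add_cancel_of_le hj, sub_self]
    · rw [Finsupp.single_le_iff, Nat.one_le_iff_ne_zero, not_not] at hj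
      rw [sub_zero, hf u (Finset.forall_mem_insert _ _ _ |>.2 ⟨hj, hu⟩)]

theorem maximalIdeal_mvPowerSeries [Finite σ] [Field K] :
    IsLocalRing.maximalIdeal (MvPowerSeries σ K) = Ideal.span (Set.range MvPowerSeries.X) := by
  have hmem (f : MvPowerSeries σ K) :
      f ∈ IsLocalRing.maximalIdeal (MvPowerSeries σ K) ↔ MvPowerSeries.constantCoeff f = 0 := by
    rw [IsLocalRing.mem_maximalIdeal, mem_nonunits_iff, MvPowerSeries.isUnit_iff_constantCoeff,
      isUnit_iff_ne_zero, not_not]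
  refine le_antisymm (fun f hf => ?_) (Ideal.span_le.2 ?_)
  · cases nonempty_fintype σ
    rw [← Set.image_univ, ← Finset.coe_univ]
    refine mem_span_X_image_of_coeff_eq_zero _ fun u hu => ?_
    rw [(Finsupp.ext fun j => hu j (Finset.mem_univ j) : u = 0)]
    exact (hmem f).1 hf
  · rintro _ ⟨j, rfl⟩
    exact (hmem _).2 (MvPowerSeries.constantCoeff_X j)

instance [Finite σ] [Field K] :
    IsAdicComplete (IsLocalRing.maximalIdeal (MvPowerSeries σ K)) (MvPowerSeries σ K) := by
  rw [maximalIdeal_mvPowerSeries]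
  infer_instance

end MaximalIdeal

section RationalToAlgebraic

variable {K : Type*} [Field K] {n : ℕ}

theorem constantCoeff_coeff_of_X_pow_mul_eq_shearPoly {R : Type*} [CommRing R] {m : ℕ}
    {Q : MvPolynomial (Fin (n + 1 + 1)) R} {D : (MvPolynomial (Fin (n + 1)) R)[X]}
    (hD : MvPolynomial.X 0 ^ m * Q = shearPoly D) :
    MvPolynomial.constantCoeff (D.coeff m) = MvPolynomial.constantCoeff Q := by
  have hy := yCoeff_X_pow_mul m 0 (Q : MvPowerSeries (Fin (n + 1 + 1)) R)
  rw [← MvPolynomial.coe_X, ← MvPolynomial.coe_pow, ← MvPolynomial.coe_mul, hD, coe_shearPoly,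
    yCoeff_shearSubst, Polynomial.coeff_coe, Polynomial.coeff_map, add_zero] at hy
  rw [← constantCoeff_algebraMap_mvPowerSeries, hy, constantCoeff_yCoeff_zero,
    ← algebraMap_mvPowerSeries_apply, constantCoeff_algebraMap_mvPowerSeries]

theorem exists_shearSubst_mul_eq {h : MvPowerSeries (Fin (n + 1 + 1)) K}
    (hh : IsRegularRational h) :
    ∃ (D N : (MvPolynomial (Fin (n + 1)) K)[X]) (m : ℕ),
      MvPolynomial.constantCoeff (D.coeff m) ≠ 0 ∧
        shearSubst (D.map (algebraMap _ (MvPowerSeries (Fin (n + 1)) K))) * h =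
          shearSubst (N.map (algebraMap _ (MvPowerSeries (Fin (n + 1)) K))) := by
  obtain ⟨P, Q, hQ, hQh⟩ := hh
  obtain ⟨a, D, hD⟩ := exists_X_pow_mul_eq_shearPoly Q
  obtain ⟨b, N, hN⟩ := exists_X_pow_mul_eq_shearPoly P
  refine ⟨Polynomial.X ^ b * D, Polynomial.X ^ a * N, a + b, ?_, ?_⟩
  · rwa [Polynomial.coeff_X_pow_mul, constantCoeff_coeff_of_X_pow_mul_eq_shearPoly hD]
  · rw [← coe_shearPoly, ← coe_shearPoly, map_mul, map_mul, map_pow, map_pow, shearPoly_X, ← hD,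
      ← hN]
    simp only [MvPolynomial.coe_mul, ← hQh]
    ring

theorem exists_eq_mul_add_mul_of_isCoprime {A : Type*} [CommRing A] [Nontrivial A] {S L : A[X]}
    (hS : S.Monic) (hSL : IsCoprime S L) (N : A[X]) :
    ∃ G r : A[X], r.degree < S.degree ∧ N = S * G + r * L := by
  obtain ⟨u, v, huv⟩ := hSL
  refine ⟨N * u + (N * v /ₘ S) * L, N * v %ₘ S, Polynomial.degree_modByMonic_lt _ hS, ?_⟩
  linear_combination (-N) * huv - L * Polynomial.modByMonic_add_div (N * v) S

theorem isDistinguishedAt_map_maximalIdeal {A B : Type*} [CommRing A] [CommRing B] [IsLocalRing A]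
    [IsLocalRing B] (φ : A →+* B) [IsLocalHom φ] {S : A[X]}
    (hS : S.IsDistinguishedAt (IsLocalRing.maximalIdeal A)) :
    (S.map φ).IsDistinguishedAt (IsLocalRing.maximalIdeal B) := by
  refine ⟨⟨fun {i} hi => ?_⟩, hS.monic.map φ⟩
  rw [hS.monic.natDegree_map] at hi
  rw [Polynomial.coeff_map]
  exact map_nonunit φ _ (hS.mem hi)

theorem isAlgebraicSeries_yCoeff_zero {h : MvPowerSeries (Fin (n + 1 + 1)) K}
    (hh : IsRegularRational h) : IsAlgebraicSeries (yCoeff 0 h) := by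
  obtain ⟨D, N, m, hm, hDN⟩ := exists_shearSubst_mul_eq hh
  have : IsDomain (MvPowerSeries (Fin (n + 1)) K) := NoZeroDivisors.to_isDomain _
  obtain ⟨S, L, hS, hL, hSL⟩ := exists_isDistinguishedAt_mul_algebraicClosure (D := D) (m := m)
    (A := MvPowerSeries (Fin (n + 1)) K) (by
      rwa [MvPowerSeries.isUnit_iff_constantCoeff, constantCoeff_algebraMap_mvPowerSeries,
        isUnit_iff_ne_zero])
  let B := Subalgebra.algebraicClosure (MvPolynomial (Fin (n + 1)) K)
    (MvPowerSeries (Fin (n + 1)) K)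
  let ι := B.val.toRingHom
  obtain ⟨G, r, hr, hN⟩ := exists_eq_mul_add_mul_of_isCoprime hS.monic
    (isCoprime_of_isDistinguishedAt hS hL) (N.map (algebraMap _ B))
  have hmap (p : (MvPolynomial (Fin (n + 1)) K)[X]) :
      p.map (algebraMap _ (MvPowerSeries (Fin (n + 1)) K)) = (p.map (algebraMap _ B)).map ι := by
    rw [Polynomial.map_map]
    rfl
  rw [hmap, hmap, hSL, hN] at hDN
  simp only [Polynomial.map_mul, Polynomial.map_add] at hDN
  have hSι := isDistinguishedAt_map_maximalIdeal ι hS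
  rw [maximalIdeal_mvPowerSeries] at hSι
  have hLι : IsUnit ((L.map ι).coeff 0) := by
    rw [Polynomial.coeff_map]
    exact hL.map ι
  have key := coeff_zero_mul_yCoeff_zero_of_shearSubst_mul_eq hSι hLι (r := r.map ι) (by
    rwa [hS.monic.degree_map, Polynomial.degree_map_eq_of_injective Subtype.val_injective]) hDN
  obtain ⟨M, hM⟩ := hL.exists_left_inv
  rw [Polynomial.coeff_map, Polynomial.coeff_map] at key
  have hy : yCoeff 0 h = ι (M * G.coeff 0) := by
    rw [map_mul, ← key, ← mul_assoc, ← map_mul, hM, map_one, one_mul]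
  rw [hy]
  exact (M * G.coeff 0).2

theorem exists_isAlgebraicSeries_diagonal_eq {h : MvPowerSeries (Fin (n + 1 + 1)) K}
    (hh : IsRegularRational h) :
    ∃ g : MvPowerSeries (Fin (n + 1)) K, IsAlgebraicSeries g ∧ diagonal h = diagonal g :=
  ⟨yCoeff 0 h, isAlgebraicSeries_yCoeff_zero hh, (diagonal_yCoeff_zero h).symm⟩

end RationalToAlgebraic

section Hadamard

variable {σ R : Type*}

open Classical in
theorem coeff_toMvPowerSeries [CommSemiring R] (i : σ) (f : PowerSeries R) (u : σ →₀ ℕ) :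
    MvPowerSeries.coeff u (f.toMvPowerSeries i) =
      if u = Finsupp.single i (u i) then PowerSeries.coeff (u i) f else 0 := by
  split_ifs with hu
  · have h := MvPowerSeries.coeff_embDomain_rename (Function.Embedding.punit i) f
      (Finsupp.single () (u i))
    rw [Finsupp.embDomain_single] at h
    rw [hu, Finsupp.single_eq_same]
    exact h
  · refine MvPowerSeries.coeff_rename_eq_zero (fun _ => i) f ?_
    rintro ⟨v, rfl⟩
    rw [Finsupp.unique_single v, Finsupp.mapDomain_single] at hu
    simp at hu

theorem coe_toMvPolynomial [CommSemiring R] (i : σ) (p : R[X]) :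
    (p.toMvPolynomial i : MvPowerSeries σ R) = (p : PowerSeries R).toMvPowerSeries i := by
  have h : (MvPolynomial.coeToMvPowerSeries.algHom R).comp (Polynomial.toMvPolynomial i) =
      (PowerSeries.toMvPowerSeries i).comp (Polynomial.coeToPowerSeries.algHom R) :=
    Polynomial.algHom_ext (by simp)
  simpa using DFunLike.congr_fun h p

theorem isAlgebraic_toMvPowerSeries [CommRing R] (i : σ) {f : PowerSeries R}
    (hf : IsAlgebraic R[X] f) : IsAlgebraic (MvPolynomial σ R) (f.toMvPowerSeries i) := by
  refine hf.ringHom_of_comp_eq (Polynomial.toMvPolynomial (R := R) i)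
    (PowerSeries.toMvPowerSeries i) (Polynomial.toMvPolynomial_injective i) ?_
  refine RingHom.ext fun p => ?_
  simp only [RingHom.comp_apply, algebraMap_mvPowerSeries_apply]
  exact coe_toMvPolynomial i p

theorem coeff_prod_toMvPowerSeries [CommSemiring R] [Fintype σ] (h : σ → PowerSeries R)
    (u : σ →₀ ℕ) :
    MvPowerSeries.coeff u (∏ i, (h i).toMvPowerSeries i) =
      ∏ i, PowerSeries.coeff (u i) (h i) := by
  classical
  have hsum : ∑ i, Finsupp.single i (u i) = u := by
    rw [← Finsupp.sum_fintype u _ (by simp), Finsupp.sum_single]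
  rw [MvPowerSeries.coeff_prod, Finset.sum_eq_single
    (Finsupp.equivFunOnFinite.symm fun i => Finsupp.single i (u i))]
  · simp [coeff_toMvPowerSeries]
  · intro l hl hne
    by_contra h0
    have hsingle (i : σ) : l i = Finsupp.single i (l i i) := by
      by_contra hi
      refine h0 (Finset.prod_eq_zero (Finset.mem_univ i) ?_)
      rw [coeff_toMvPowerSeries, if_neg hi]
    refine hne (Finsupp.ext fun i => ?_)
    have hu : u i = l i i := by
      rw [← (Finset.mem_finsuppAntidiag.1 hl).1, Finsupp.finsetSum_apply,
        Finset.sum_eq_single i (fun j _ hj => ?_) (by simp)]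
      rw [hsingle j, Finsupp.single_eq_of_ne hj.symm]
    rw [hsingle i, Finsupp.equivFunOnFinite_symm_apply_apply, hu]
  · intro hu
    simp [Finset.mem_finsuppAntidiag, hsum] at hu

variable {K : Type*} [Field K]

theorem exists_isAlgebraicSeries_hadamardProd_eq {n : ℕ} {h : Fin (n + 1) → PowerSeries K}
    (hh : ∀ i, IsAlgebraic K[X] (h i)) :
    ∃ g : MvPowerSeries (Fin (n + 1)) K, IsAlgebraicSeries g ∧ hadamardProd h = diagonal g := by
  refine ⟨∏ i, (h i).toMvPowerSeries i,
    Subalgebra.prod_mem (Subalgebra.algebraicClosure (MvPolynomial (Fin (n + 1)) K) _)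
      fun i _ => isAlgebraic_toMvPowerSeries i (hh i), ?_⟩
  ext m
  simp [diagonal, hadamardProd, coeff_prod_toMvPowerSeries]

theorem exists_coeff_zero_ne_zero_of_coe_mul_eq_coe [CommRing R] [IsDomain R] {P Q : R[X]}
    {f : PowerSeries R} (hQ : Q ≠ 0) (hf : (Q : PowerSeries R) * f = P) :
    ∃ P' Q' : R[X], Q'.coeff 0 ≠ 0 ∧ (Q' : PowerSeries R) * f = P' := by
  obtain ⟨Q', hQQ', hQ'⟩ :=
    (Polynomial.finiteMultiplicity_X_sub_C 0 hQ).exists_eq_pow_mul_and_not_dvd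
  rw [map_zero, sub_zero] at hQQ' hQ'
  generalize multiplicity (Polynomial.X : R[X]) Q = k at hQQ'
  rw [hQQ', Polynomial.coe_mul, Polynomial.coe_pow, Polynomial.coe_X, mul_assoc] at hf
  obtain ⟨P', rfl⟩ : Polynomial.X ^ k ∣ P := Polynomial.X_pow_dvd_iff.2 fun d hd => by
    rw [← Polynomial.coeff_coe, ← hf, PowerSeries.coeff_X_pow_mul', if_neg hd.not_ge]
  rw [Polynomial.coe_mul, Polynomial.coe_pow, Polynomial.coe_X] at hf
  exact ⟨P', Q', mt Polynomial.X_dvd_iff.2 hQ', mul_left_cancel₀ (by simp) hf⟩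

theorem IsRationalSeries.exists_isRegularRational {f : PowerSeries K} (hf : IsRationalSeries f) :
    ∃ h : MvPowerSeries (Fin (0 + 1)) K, IsRegularRational h ∧ f = diagonal h := by
  obtain ⟨_, _, hQ₀, hf₀⟩ := hf
  obtain ⟨P, Q, hQ, hPQ⟩ := exists_coeff_zero_ne_zero_of_coe_mul_eq_coe hQ₀ hf₀
  refine ⟨f.toMvPowerSeries 0, ⟨P.toMvPolynomial 0, Q.toMvPolynomial 0, ?_, ?_⟩, ?_⟩
  · rwa [MvPolynomial.constantCoeff_eq, ← MvPolynomial.coeff_coe, coe_toMvPolynomial,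
      coeff_toMvPowerSeries, if_pos (by simp), Polynomial.coeff_coe]
  · rw [coe_toMvPolynomial, coe_toMvPolynomial, ← map_mul, hPQ]
  · ext m
    rw [diagonal, PowerSeries.coeff_mk, coeff_toMvPowerSeries, if_pos]
    · simp
    · ext j
      fin_cases j
      simp

theorem diagonalGrade_le_hadamardGrade [CharZero K] (f : PowerSeries K) :
    diagonalGrade f ≤ hadamardGrade f := by
  rw [hadamardGrade]
  split_ifs with hf
  · exact sInf_le ⟨0, rfl, hf.exists_isRegularRational⟩
  · refine le_sInf ?_
    rintro _ ⟨k, rfl, hk, h, hh, rfl⟩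
    obtain ⟨n, rfl⟩ := Nat.exists_eq_add_of_le' hk
    obtain ⟨g, hg, hgd⟩ := exists_isAlgebraicSeries_hadamardProd_eq hh
    obtain ⟨r, hr, hrd⟩ := exists_isRegularRational_diagonal_eq hg
    exact sInf_le ⟨n + 1, rfl, r, hr, hgd.trans hrd⟩

end Hadamard

end

end DiagonalGrade

theorem lemmal_general {K : Type*} [Field K] [CharZero K] (f : PowerSeries K) :
    (∀ n : ℕ,
      (∃ g : MvPowerSeries (Fin (n + 1)) K,
        DiagonalGrade.IsAlgebraicSeries g ∧ f = DiagonalGrade.diagonal g) ↔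
      (∃ h : MvPowerSeries (Fin (n + 1 + 1)) K,
        DiagonalGrade.IsRegularRational h ∧ f = DiagonalGrade.diagonal h)) ∧
    DiagonalGrade.diagonalGrade f ≤ DiagonalGrade.hadamardGrade f := by
  refine ⟨fun n => ⟨?_, ?_⟩, DiagonalGrade.diagonalGrade_le_hadamardGrade f⟩
  · rintro ⟨g, hg, rfl⟩
    exact DiagonalGrade.exists_isRegularRational_diagonal_eq hg
  · rintro ⟨h, hh, rfl⟩
    exact DiagonalGrade.exists_isAlgebraicSeries_diagonal_eq hh

theorem lemmal {K : Type*} [Field K] [NumberField K] (f : PowerSeries K)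
    (hf : DiagonalGrade.IsDFinite f) :
    (∀ n : ℕ,
      (∃ g : MvPowerSeries (Fin (n + 1)) K,
        DiagonalGrade.IsAlgebraicSeries g ∧ f = DiagonalGrade.diagonal g) ↔
      (∃ h : MvPowerSeries (Fin (n + 1 + 1)) K,
        DiagonalGrade.IsRegularRational h ∧ f = DiagonalGrade.diagonal h)) ∧
    DiagonalGrade.diagonalGrade f ≤ DiagonalGrade.hadamardGrade f := by
  exact lemmal_general f
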